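/- Identify $k\ge 1$ with $\{0,\dots,k-1\}$. A coloring $c:[\omega]^2\to k$ is \emph{stable} if for every $x$ the limit $\lim_y c(x,y)$ exists. A set $H\subseteq\omega$ is \emph{homogeneous} for $c$ if $c$ is constant on $[H]^2$, and $L\subseteq\omega$ is \emph{limit-homogeneous} for $c$ if there is a $j<k$ with $\lim_y c(x,y)=j$ for all $x\in L$. The instances of $\mathsf{SRT}^2_k$ are the stable colorings $c:[\omega]^2\to k$, and the solutions to $c$ are its infinite homogeneous sets. The instances of $\mathsf{D}^2_k$ are the same, and the solutions to $c$ are its infinite limit-homogeneous sets. $\mathsf{D}^2_{<\infty}$ is the principle $\forall k\,\mathsf{D}^2_k$: its instances are the pairs $(k,c)$ with $c:[\omega]^2\to k$ stable, and the solutions to $(k,c)$ are the infinite limit-homogeneous sets for $c$. A principle $\mathsf{Q}$ is \emph{uniformly reducible} to $\mathsf{P}$, written $\mathsf{Q}\leq_{\mathrm u}\mathsf{P}$, if there are Turing functionals $\Phi$ and $\Psi$ such that for every instance $X$ of $\mathsf{Q}$, $\Phi^X$ is an instance of $\mathsf{P}$, and for every solution $\widehat Y$ to $\Phi^X$, $\Psi^{X\oplus\widehat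 Y}$ is a solution to $X$. Then $\mathsf{SRT}^2_2\nleq_{\mathrm u}\mathsf{D}^2_{<\infty}$, and this remains true if the number $k$ of colors is not given as part of the instances of $\mathsf{D}^2_{<\infty}$ (so that they are the stable colorings $c:[\omega]^2\to k$ for arbitrary $k$). In particular, $\mathsf{SRT}^2_2\nleq_{\mathrm u}\mathsf{D}^2_2$. -/

import Mathlib

namespace RamseyReductions

/-- Programs for Turing functionals: the schemes generating the partial recursive functions,
together with a query to an oracle. -/
inductive OracleCode : Type
  | zero : OracleCode
  | succ : OracleCode
  | left : OracleCode
  | right : OracleCode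
  | oracle : OracleCode
  | pair : OracleCode → OracleCode → OracleCode
  | comp : OracleCode → OracleCode → OracleCode
  | prec : OracleCode → OracleCode → OracleCode
  | rfind : OracleCode → OracleCode

/-- `Φ.eval X n` is the (possibly undefined) value `Φ^X(n)` of the Turing functional with
program `Φ` at input `n` and oracle `X : ℕ → ℕ`. The clauses are those of `Nat.RecursiveIn`. -/
def OracleCode.eval : OracleCode → (ℕ → ℕ) → ℕ →. ℕ
  | .zero, _ => fun _ => 0
  | .succ, _ => (Nat.succ : ℕ →. ℕ)
  | .left, _ => fun n => ((Nat.unpair n).1 : ℕ)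
  | .right, _ => fun n => ((Nat.unpair n).2 : ℕ)
  | .oracle, X => (X : ℕ →. ℕ)
  | .pair f h, X => fun n => Nat.pair <$> f.eval X n <*> h.eval X n
  | .comp f h, X => fun n => h.eval X n >>= f.eval X
  | .prec f h, X => fun p =>
      let (a, n) := Nat.unpair p
      n.rec (f.eval X a) fun y IH => do
        let i ← IH
        h.eval X (Nat.pair a (Nat.pair y i))
  | .rfind f, X => fun a =>
      Nat.rfind fun n => (fun m => m = 0) <$> f.eval X (Nat.pair a n)

/-- For a fixed oracle `X`, the functions `Φ^X` are exactly the partial functions recursive in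
`X` in the sense of Mathlib. -/
theorem OracleCode.exists_eval_eq_iff (X : ℕ → ℕ) (g : ℕ →. ℕ) :
    (∃ Φ : OracleCode, Φ.eval X = g) ↔ Nat.RecursiveIn {(X : ℕ →. ℕ)} g := by
  constructor
  · rintro ⟨Φ, rfl⟩
    induction Φ with
    | zero => exact .zero
    | succ => exact .succ
    | left => exact .left
    | right => exact .right
    | oracle => exact .oracle _ rfl
    | pair f h hf hh => exact .pair hf hh
    | comp f h hf hh => exact .comp hf hh
    | prec f h hf hh => exact .prec hf hh
    | rfind f hf => exact .rfind hf
  · intro hg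
    induction hg with
    | zero => exact ⟨.zero, rfl⟩
    | succ => exact ⟨.succ, rfl⟩
    | left => exact ⟨.left, rfl⟩
    | right => exact ⟨.right, rfl⟩
    | oracle g hg => exact ⟨.oracle, (Set.mem_singleton_iff.mp hg).symm⟩
    | pair _ _ ihf ihh =>
      obtain ⟨⟨f, rfl⟩, ⟨h, rfl⟩⟩ := And.intro ihf ihh
      exact ⟨.pair f h, rfl⟩
    | comp _ _ ihf ihh =>
      obtain ⟨⟨f, rfl⟩, ⟨h, rfl⟩⟩ := And.intro ihf ihh
      exact ⟨.comp f h, rfl⟩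
    | prec _ _ ihf ihh =>
      obtain ⟨⟨f, rfl⟩, ⟨h, rfl⟩⟩ := And.intro ihf ihh
      exact ⟨.prec f h, rfl⟩
    | rfind _ ihf =>
      obtain ⟨f, rfl⟩ := ihf
      exact ⟨.rfind f, rfl⟩

/-- `Φ^X` is total and equal to `Y`. -/
def OracleCode.Computes (Φ : OracleCode) (X Y : ℕ → ℕ) : Prop :=
  ∀ n, Φ.eval X n = Part.some (Y n)

/-- The join `X ⊕ Y`: it is `X` on the even numbers and `Y` on the odd numbers. -/
def join (X Y : ℕ → ℕ) : ℕ → ℕ :=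
  fun n => if n % 2 = 0 then X (n / 2) else Y (n / 2)

/-- A principle "every instance has a solution", with instances and solutions (coded as)
functions `ℕ → ℕ`. -/
structure Principle where
  IsInstance : (ℕ → ℕ) → Prop
  IsSolution : (ℕ → ℕ) → (ℕ → ℕ) → Prop

/-- `Q ≤ᵤ P`: there are Turing functionals `Φ` and `Ψ` such that for every instance `X` of `Q`,
`Φ^X` is an instance of `P`, and for every solution `Y'` to `Φ^X`, `Ψ^(X ⊕ Y')` is a solution
to `X`. -/
def UniformlyReducible (Q P : Principle) : Prop :=
  ∃ Φ Ψ : OracleCode, ∀ X, Q.IsInstance X →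
    ∃ X', Φ.Computes X X' ∧ P.IsInstance X' ∧
      ∀ Y', P.IsSolution X' Y' →
        ∃ Y, Ψ.Computes (join X Y') Y ∧ Q.IsSolution X Y

/-- `c` codes the coloring `{x < y} ↦ c ⟨x, y⟩` of `[ω]^2` with colors `0, …, k - 1`.
The entries of `c` that do not correspond to pairs `x < y` are `0`. -/
def IsColoring (k : ℕ) (c : ℕ → ℕ) : Prop :=
  (∀ x y, x < y → c (Nat.pair x y) < k) ∧ ∀ x y, y ≤ x → c (Nat.pair x y) = 0

/-- `lim_y c(x, y) = j`. -/
def HasLimitColor (c : ℕ → ℕ) (x j : ℕ) : Prop :=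
  ∃ z, ∀ y, z ≤ y → x < y → c (Nat.pair x y) = j

/-- `c` is a stable coloring `[ω]^2 → k`. -/
def IsStableColoring (k : ℕ) (c : ℕ → ℕ) : Prop :=
  IsColoring k c ∧ ∀ x, ∃ j, j < k ∧ HasLimitColor c x j

/-- `H` is homogeneous for the coloring `c`. -/
def IsHomogeneous (c : ℕ → ℕ) (H : Set ℕ) : Prop :=
  ∃ j, ∀ x ∈ H, ∀ y ∈ H, x < y → c (Nat.pair x y) = j

/-- `L` is limit-homogeneous for the coloring `c`. -/
def IsLimitHomogeneous (c : ℕ → ℕ) (L : Set ℕ) : Prop :=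
  ∃ j, ∀ x ∈ L, HasLimitColor c x j

/-- `Y` is the characteristic function of the set `S`. -/
def IsCharFun (Y : ℕ → ℕ) (S : Set ℕ) : Prop :=
  ∀ n, (n ∈ S ∧ Y n = 1) ∨ (n ∉ S ∧ Y n = 0)

/-- `SRT²ₖ`: every stable coloring `c : [ω]^2 → k` has an infinite homogeneous set. -/
def SRT2 (k : ℕ) : Principle where
  IsInstance c := IsStableColoring k c
  IsSolution c Y := ∃ H : Set ℕ, IsCharFun Y H ∧ H.Infinite ∧ IsHomogeneous c H

/-- `D²ₖ`: every stable coloring `c : [ω]^2 → k` has an infinite limit-homogeneous set. -/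
def D2 (k : ℕ) : Principle where
  IsInstance c := IsStableColoring k c
  IsSolution c Y := ∃ L : Set ℕ, IsCharFun Y L ∧ L.Infinite ∧ IsLimitHomogeneous c L

/-- `D²_{<∞}`, the statement `∀ k, D²ₖ`. An instance is a pair `(k, c)` with `c` a stable coloring
`[ω]^2 → k`, coded by the function with value `k` at `0` and `c n` at `n + 1`. -/
def D2Fin : Principle where
  IsInstance X := IsStableColoring (X 0) (fun n => X (n + 1))
  IsSolution X Y := (D2 (X 0)).IsSolution (fun n => X (n + 1)) Y

/-- The variant of `D²_{<∞}` in which an instance is a stable coloring `c : [ω]^2 → k` for some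
`k`, with `k` not given as part of the instance. -/
def D2FinUnknown : Principle where
  IsInstance c := ∃ k, IsStableColoring k c
  IsSolution c Y := ∃ L : Set ℕ, IsCharFun Y L ∧ L.Infinite ∧ IsLimitHomogeneous c L

end RamseyReductions

namespace RamseyReductions

open Filter Topology Set

/-! Turing functionals are continuous, so it suffices to defeat a continuous `D` paired with a
functional `Ψ`. Baire space parametrizes the colorings with all limit colors 1, row by row, through
`bitColoring`, so category arguments apply to `D ∘ bitColoring`: on some nonempty open set, the
images of generic points share a bound `k` on their colors, and every limit color occurring from
some `n` on occurs infinitely often (`exists_open_dense_infinite_colors`).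

Generic colorings `c_M` from that set converge to a coloring `c` whose rows from some `s` on are
constantly 0. Let `L` be infinite and limit-homogeneous for `D c`, such that along a subsequence the
limit colors of `D c_M` at each point of `L` converge to one color `b`. From `c` and `L`, `Ψ`
computes an infinite homogeneous set for `c`, necessarily of color 0; fix `x < y` in it. Genericity
extends long initial segments of `L` to infinite sets limit-homogeneous for `D c_M` with color `b`.
By continuity `Ψ` still accepts `x` and `y`, and `c_M(x, y) = 0`, although infinite homogeneous sets
for `c_M` have color 1 (`not_continuously_reducible`). -/

/-! ### Continuity of Turing functionals -/

/-- The use principle: a halting computation consults only finitely many values of its oracle. -/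
theorem OracleCode.eventually_mem_eval (Φ : OracleCode) {X : ℕ → ℕ} {n v : ℕ}
    (h : v ∈ Φ.eval X n) : ∀ᶠ X' in 𝓝 X, v ∈ Φ.eval X' n := by
  induction Φ generalizing n v with
  | zero => exact Eventually.of_forall fun _ => h
  | succ => exact Eventually.of_forall fun _ => h
  | left => exact Eventually.of_forall fun _ => h
  | right => exact Eventually.of_forall fun _ => h
  | oracle =>
    have h1 : ∀ᶠ X' in 𝓝 X, X' n = X n := by
      have : Tendsto (fun X' : ℕ → ℕ => X' n) (𝓝 X) (𝓝 (X n)) := (continuous_apply n).tendsto X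
      rwa [nhds_discrete ℕ, tendsto_pure] at this
    filter_upwards [h1] with X' hX'
    simpa [OracleCode.eval, hX'] using h
  | pair f g hf hg =>
    simp only [OracleCode.eval, Seq.seq, Part.map_eq_map, Part.mem_bind_iff, Part.mem_map_iff] at h ⊢
    obtain ⟨_, ⟨a, ha, rfl⟩, b, hb, rfl⟩ := h
    filter_upwards [hf ha, hg hb] with X' h1 h2
    exact ⟨_, ⟨a, h1, rfl⟩, b, h2, rfl⟩
  | comp f g hf hg =>
    obtain ⟨a, ha, hv⟩ := Part.mem_bind_iff.mp h
    filter_upwards [hg ha, hf hv] with X' h1 h2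
    exact Part.mem_bind_iff.mpr ⟨a, h1, h2⟩
  | prec f g hf hg =>
    simp only [OracleCode.eval] at h ⊢
    generalize (Nat.unpair n).1 = a at h ⊢
    generalize (Nat.unpair n).2 = m at h ⊢
    induction m generalizing v with
    | zero => exact hf h
    | succ m ih =>
      simp only [Part.bind_eq_bind, Part.mem_bind_iff] at h ⊢
      obtain ⟨i, hi, hv⟩ := h
      filter_upwards [ih hi, hg hv] with X' h1 h2
      exact ⟨i, h1, h2⟩
  | rfind f hf =>
    obtain ⟨hv, hlt⟩ := Nat.mem_rfind.mp h
    obtain ⟨a, ha, ha0⟩ := (Part.mem_map_iff _).mp hv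
    have h2 : ∀ᶠ X' in 𝓝 X, ∀ m ∈ Finset.range v,
        ∃ b, b ∈ f.eval X' (Nat.pair n m) ∧ decide (b = 0) = false := by
      rw [Filter.eventually_all_finset]
      intro m hm
      obtain ⟨b, hb, hb0⟩ := (Part.mem_map_iff _).mp (hlt (Finset.mem_range.mp hm))
      filter_upwards [hf hb] with X' hX'
      exact ⟨b, hX', hb0⟩
    filter_upwards [hf ha, h2] with X' h1 h2
    exact Nat.mem_rfind.mpr ⟨(Part.mem_map_iff _).mpr ⟨a, h1, ha0⟩, fun {m} hm =>
      (Part.mem_map_iff _).mpr (h2 m (Finset.mem_range.mpr hm))⟩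

theorem OracleCode.continuousOn_of_computes {Φ : OracleCode} {D : (ℕ → ℕ) → ℕ → ℕ}
    {S : Set (ℕ → ℕ)} (h : ∀ X ∈ S, Φ.Computes X (D X)) : ContinuousOn D S := by
  refine continuousOn_pi.mpr fun n X hX => ?_
  rw [ContinuousWithinAt, nhds_discrete, tendsto_pure]
  have h1 : D X n ∈ Φ.eval X n := by rw [h X hX n]; exact Part.mem_some _
  filter_upwards [mem_nhdsWithin_of_mem_nhds (Φ.eventually_mem_eval h1), self_mem_nhdsWithin]
    with X' h2 h3
  rw [h X' h3 n] at h2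
  exact (Part.mem_some_iff.mp h2).symm

theorem continuous_join : Continuous fun p : (ℕ → ℕ) × (ℕ → ℕ) => join p.1 p.2 := by
  refine continuous_pi fun n => ?_
  unfold join
  split_ifs <;> fun_prop

/-! ### Limit colors and the two kinds of colorings -/

/-- The characteristic function of `L`. -/
noncomputable def charFun (L : Set ℕ) : ℕ → ℕ := L.indicator 1

theorem isCharFun_charFun (L : Set ℕ) : IsCharFun (charFun L) L := by
  intro n
  by_cases h : n ∈ L <;> simp [charFun, h]

theorem HasLimitColor.unique {c : ℕ → ℕ} {x i j : ℕ} (hi : HasLimitColor c x i)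
    (hj : HasLimitColor c x j) : i = j := by
  obtain ⟨a, ha⟩ := hi
  obtain ⟨b, hb⟩ := hj
  rw [← ha (a + b + x + 1) (by omega) (by omega), hb (a + b + x + 1) (by omega) (by omega)]

/-- An infinite homogeneous set takes the limit color of each of its elements. -/
theorem eq_limitColor_of_homogeneous {c : ℕ → ℕ} {H : Set ℕ} (hH : H.Infinite)
    (hom : IsHomogeneous c H) {x y w j : ℕ} (hx : x ∈ H) (hy : y ∈ H) (hxy : x < y) (hw : w ∈ H)
    (hj : HasLimitColor c w j) : c (Nat.pair x y) = j := by
  obtain ⟨i, hi⟩ := hom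
  obtain ⟨a, ha⟩ := hj
  obtain ⟨z, hz, hz'⟩ := hH.exists_gt (a + w)
  rw [hi x hx y hy hxy, ← hi w hw z hz (by omega), ha z (by omega) (by omega)]

/-- The coloring whose row `x` has color `0` at the binary digits `1` of `ξ x` and `1` elsewhere. -/
def bitColoring (ξ : ℕ → ℕ) (n : ℕ) : ℕ :=
  if n.unpair.1 < n.unpair.2 then (if (ξ n.unpair.1).testBit n.unpair.2 then 0 else 1) else 0

theorem bitColoring_pair (ξ : ℕ → ℕ) (x y : ℕ) : bitColoring ξ (Nat.pair x y) =
    if x < y then (if (ξ x).testBit y then 0 else 1) else 0 := by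
  simp [bitColoring]

theorem continuous_bitColoring : Continuous bitColoring := by
  refine continuous_pi fun n => ?_
  exact (continuous_of_discreteTopology (f := fun r : ℕ =>
    if n.unpair.1 < n.unpair.2 then (if r.testBit n.unpair.2 then 0 else 1) else 0)).comp
    (continuous_apply n.unpair.1)

theorem hasLimitColor_bitColoring (ξ : ℕ → ℕ) (x : ℕ) : HasLimitColor (bitColoring ξ) x 1 := by
  refine ⟨ξ x, fun y hy hxy => ?_⟩
  rw [bitColoring_pair, if_pos hxy,
    Nat.testBit_eq_false_of_lt (hy.trans_lt Nat.lt_two_pow_self)]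
  simp

theorem isStableColoring_bitColoring (ξ : ℕ → ℕ) : IsStableColoring 2 (bitColoring ξ) := by
  refine ⟨⟨fun x y _ => ?_, fun x y h => ?_⟩, fun x => ⟨1, one_lt_two, hasLimitColor_bitColoring ξ x⟩⟩
  · rw [bitColoring_pair]; split_ifs <;> simp
  · rw [bitColoring_pair, if_neg h.not_gt]

/-- The coloring with the rows of `bitColoring ξ` below `s` and constant color `0` above. -/
def truncColoring (ξ : ℕ → ℕ) (s n : ℕ) : ℕ := if n.unpair.1 < s then bitColoring ξ n else 0

theorem hasLimitColor_truncColoring_of_lt (ξ : ℕ → ℕ) {s x : ℕ} (h : x < s) :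
    HasLimitColor (truncColoring ξ s) x 1 := by
  obtain ⟨z, hz⟩ := hasLimitColor_bitColoring ξ x
  exact ⟨z, fun y hy hxy => by simp [truncColoring, h, hz y hy hxy]⟩

theorem hasLimitColor_truncColoring_of_le (ξ : ℕ → ℕ) {s x : ℕ} (h : s ≤ x) :
    HasLimitColor (truncColoring ξ s) x 0 :=
  ⟨0, fun y _ _ => by simp [truncColoring, h.not_gt]⟩

theorem isStableColoring_truncColoring (ξ : ℕ → ℕ) (s : ℕ) :
    IsStableColoring 2 (truncColoring ξ s) := by
  have h := isStableColoring_bitColoring ξ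
  refine ⟨⟨fun x y hxy => ?_, fun x y hxy => ?_⟩, fun x => ?_⟩
  · unfold truncColoring; split_ifs
    exacts [h.1.1 x y hxy, two_pos]
  · unfold truncColoring; split_ifs
    exacts [h.1.2 x y hxy, rfl]
  · rcases lt_or_ge x s with hx | hx
    · exact ⟨1, one_lt_two, hasLimitColor_truncColoring_of_lt ξ hx⟩
    · exact ⟨0, two_pos, hasLimitColor_truncColoring_of_le ξ hx⟩

/-- The binary digits of `2 ^ M - 1` at the places below `M` are all 1, so rows from `s` on show
color 0 for longer and longer. -/
theorem tendsto_bitColoring_truncColoring {ξ₀ : ℕ → ℕ} {s : ℕ} {ξ : ℕ → ℕ → ℕ}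
    (hξ : ∀ M, ∀ x < s + M, ξ M x = if x < s then ξ₀ x else 2 ^ M - 1) :
    Tendsto (fun M => bitColoring (ξ M)) atTop (𝓝 (truncColoring ξ₀ s)) := by
  refine tendsto_pi_nhds.mpr fun n => tendsto_nhds_of_eventually_eq ?_
  filter_upwards [eventually_gt_atTop n.unpair.1, eventually_gt_atTop n.unpair.2] with M h1 h2
  unfold truncColoring bitColoring
  rw [hξ M _ (by omega)]
  split_ifs <;> simp_all

/-! ### Baire category for continuous families of stable colorings -/

section Generic

variable {Z : Type*} [TopologicalSpace Z]

/-- The limit color at `x` is locally constantly `j`. -/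
def LocalLimitColor (d : Z → ℕ → ℕ) (x j : ℕ) : Set Z :=
  ⋃ z, interior {ξ | ∀ y, z ≤ y → x < y → d ξ (Nat.pair x y) = j}

/-- Some `x ≥ n` has locally constant limit color `j`. -/
def LocalColorAbove (d : Z → ℕ → ℕ) (n j : ℕ) : Set Z := ⋃ x ≥ n, LocalLimitColor d x j

theorem isOpen_localLimitColor (d : Z → ℕ → ℕ) (x j : ℕ) : IsOpen (LocalLimitColor d x j) :=
  isOpen_iUnion fun _ => isOpen_interior

theorem isOpen_localColorAbove (d : Z → ℕ → ℕ) (n j : ℕ) : IsOpen (LocalColorAbove d n j) :=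
  isOpen_biUnion fun _ _ => isOpen_localLimitColor d _ j

theorem mem_localColorAbove {d : Z → ℕ → ℕ} {n j : ℕ} {ξ : Z} :
    ξ ∈ LocalColorAbove d n j ↔ ∃ x ≥ n, ξ ∈ LocalLimitColor d x j := by
  simp [LocalColorAbove]

theorem localColorAbove_anti (d : Z → ℕ → ℕ) {m n : ℕ} (h : m ≤ n) (j : ℕ) :
    LocalColorAbove d n j ⊆ LocalColorAbove d m j := by
  intro ξ hξ
  rw [mem_localColorAbove] at hξ ⊢
  obtain ⟨x, hx, h'⟩ := hξ
  exact ⟨x, h.trans hx, h'⟩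

theorem hasLimitColor_of_mem {d : Z → ℕ → ℕ} {x j : ℕ} {ξ : Z} (h : ξ ∈ LocalLimitColor d x j) :
    HasLimitColor (d ξ) x j := by
  obtain ⟨z, hz⟩ := mem_iUnion.mp h
  exact ⟨z, interior_subset hz⟩

/-- For a fixed color and a fixed stage of stabilization the condition is closed; these countably
many closed sets cover the space. -/
theorem dense_iUnion_localLimitColor [BaireSpace Z] {d : Z → ℕ → ℕ} (hd : Continuous d)
    (hlim : ∀ ξ x, ∃ j, HasLimitColor (d ξ) x j) (x : ℕ) :
    Dense (⋃ j, LocalLimitColor d x j) := by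
  have h := dense_iUnion_interior_of_closed
    (f := fun p : ℕ × ℕ => {ξ : Z | ∀ y, p.2 ≤ y → x < y → d ξ (Nat.pair x y) = p.1}) ?_ ?_
  · refine h.mono (iUnion_subset fun p => ?_)
    exact (subset_iUnion (fun z => interior
      {ξ : Z | ∀ y, z ≤ y → x < y → d ξ (Nat.pair x y) = p.1}) p.2).trans
      (subset_iUnion (fun j => LocalLimitColor d x j) p.1)
  · intro p
    simp only [ofPred_forall]
    exact isClosed_iInter fun y => isClosed_iInter fun _ => isClosed_iInter fun _ =>
      isClosed_eq ((continuous_apply _).comp hd) continuous_const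
  · refine eq_univ_of_forall fun ξ => ?_
    obtain ⟨j, z, h⟩ := hlim ξ x
    exact mem_iUnion.mpr ⟨(j, z), h⟩

/-- Every color below `k` can be made to be absent above some `n` or dense above every `m`. -/
theorem exists_open_decides_colors (d : Z → ℕ → ℕ) {U : Set Z} (hU : IsOpen U)
    (hne : U.Nonempty) (k : ℕ) : ∃ V ⊆ U, IsOpen V ∧ V.Nonempty ∧ ∃ n, ∀ j < k,
      Disjoint V (LocalColorAbove d n j) ∨ ∀ m, V ⊆ closure (LocalColorAbove d m j) := by
  induction k with
  | zero => exact ⟨U, Subset.rfl, hU, hne, 0, by simp⟩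
  | succ k ih =>
    obtain ⟨V, hVU, hV, hVne, n, hn⟩ := ih
    by_cases h : ∀ m, V ⊆ closure (LocalColorAbove d m k)
    · refine ⟨V, hVU, hV, hVne, n, fun j hj => ?_⟩
      rcases Nat.lt_succ_iff_lt_or_eq.mp hj with hj | rfl
      exacts [hn j hj, Or.inr h]
    · push Not at h
      obtain ⟨m, hm⟩ := h
      obtain ⟨ξ, h1, h2⟩ := not_subset.mp hm
      -- Where density of color `k` above `m` fails, removing the closure makes the color absent
      -- above `m`.
      refine ⟨V \ closure (LocalColorAbove d m k), sdiff_subset.trans hVU,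
        hV.sdiff isClosed_closure, ⟨ξ, h1, h2⟩, max n m, fun j hj => ?_⟩
      rcases Nat.lt_succ_iff_lt_or_eq.mp hj with hj | rfl
      · refine (hn j hj).imp (fun h => ?_) fun h m => sdiff_subset.trans (h m)
        exact h.mono sdiff_subset (localColorAbove_anti d (le_max_left _ _) j)
      · exact Or.inl (disjoint_sdiff_left.mono_right
          ((localColorAbove_anti d (le_max_right n m) j).trans subset_closure))

/-- In some nonempty open set, densely many points have all colors bounded by `k`, and all limit
colors of numbers from `n` on are the limit colors of infinitely many numbers. -/
theorem exists_open_dense_infinite_colors [Nonempty Z] [BaireSpace Z] {d : Z → ℕ → ℕ}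
    (hd : Continuous d) (hst : ∀ ξ, ∃ k, IsStableColoring k (d ξ)) :
    ∃ (V : Set Z) (n k : ℕ) (G : Set Z), IsOpen V ∧ V.Nonempty ∧ Dense G ∧ ∀ ξ ∈ V ∩ G,
      IsStableColoring k (d ξ) ∧ ∀ x ≥ n, ∀ j, HasLimitColor (d ξ) x j →
        {w | HasLimitColor (d ξ) w j}.Infinite := by
  have hlim : ∀ ξ x, ∃ j, HasLimitColor (d ξ) x j := fun ξ x => by
    obtain ⟨k, hk⟩ := hst ξ
    obtain ⟨j, -, hj⟩ := hk.2 x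
    exact ⟨j, hj⟩
  -- The number of colors may vary with the point; category makes it uniform on an open set.
  obtain ⟨k, hk⟩ := nonempty_interior_of_iUnion_of_closed
    (f := fun k : ℕ => {ξ : Z | ∀ x y, x < y → d ξ (Nat.pair x y) < k})
    (fun k => by
      simp only [ofPred_forall]
      exact isClosed_iInter fun x => isClosed_iInter fun y => isClosed_iInter fun _ =>
        (isClosed_discrete (Iio k)).preimage ((continuous_apply (Nat.pair x y)).comp hd))
    (eq_univ_of_forall fun ξ => by
      obtain ⟨k, hk⟩ := hst ξ
      exact mem_iUnion.mpr ⟨k, hk.1.1⟩)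
  obtain ⟨V, hVU, hV, hVne, n, hn⟩ := exists_open_decides_colors d isOpen_interior hk k
  -- Generic points: every limit color is locally constant, and no boundary of a set
  -- `LocalColorAbove d m j` is met.
  refine ⟨V, n, k, (⋂ x, ⋃ j, LocalLimitColor d x j) ∩ ⋂ p : ℕ × ℕ,
    (LocalColorAbove d p.1 p.2 ∪ (closure (LocalColorAbove d p.1 p.2))ᶜ), hV, hVne, ?_, ?_⟩
  · have h1 : Dense (⋂ x, ⋃ j, LocalLimitColor d x j) :=
      dense_iInter_of_isOpen (fun x => isOpen_iUnion fun j => isOpen_localLimitColor d x j)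
        (dense_iUnion_localLimitColor hd hlim)
    have h2 : Dense (⋂ p : ℕ × ℕ,
        (LocalColorAbove d p.1 p.2 ∪ (closure (LocalColorAbove d p.1 p.2))ᶜ)) := by
      refine dense_iInter_of_isOpen (fun p => (isOpen_localColorAbove d _ _).union
        isClosed_closure.isOpen_compl) fun p => ?_
      rw [dense_iff_closure_eq, closure_union, eq_univ_iff_forall]
      intro ξ
      by_cases h : ξ ∈ closure (LocalColorAbove d p.1 p.2)
      exacts [Or.inl h, Or.inr (subset_closure h)]
    refine Dense.inter_of_Gδ ?_ ?_ h1 h2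
    · exact IsGδ.iInter_of_isOpen fun x => isOpen_iUnion fun j => isOpen_localLimitColor d x j
    · exact IsGδ.iInter_of_isOpen fun p => (isOpen_localColorAbove d _ _).union
        isClosed_closure.isOpen_compl
  · rintro ξ ⟨hξV, hξ1, hξ2⟩
    have hb : ∀ x y, x < y → d ξ (Nat.pair x y) < k := interior_subset (hVU hξV)
    have hlt : ∀ x j, HasLimitColor (d ξ) x j → j < k := by
      rintro x j ⟨z, hz⟩
      rw [← hz (z + x + 1) (by omega) (by omega)]
      exact hb _ _ (by omega)
    refine ⟨⟨⟨hb, ?_⟩, fun x => ?_⟩, fun x hx j hj => ?_⟩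
    · obtain ⟨k', hk'⟩ := hst ξ
      exact hk'.1.2
    · obtain ⟨j, hj⟩ := hlim ξ x
      exact ⟨j, hlt x j hj, hj⟩
    · obtain ⟨j', hj'⟩ := mem_iUnion.mp (mem_iInter.mp hξ1 x)
      obtain rfl := hj.unique (hasLimitColor_of_mem hj')
      refine infinite_of_forall_exists_gt fun a => ?_
      rcases hn j (hlt x j hj) with h | h
      · exact absurd (mem_localColorAbove.mpr ⟨x, hx, hj'⟩) (disjoint_left.mp h hξV)
      · rcases mem_iInter.mp hξ2 (a + 1, j) with h' | h'
        · obtain ⟨w, hw, hw'⟩ := mem_localColorAbove.mp h'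
          exact ⟨w, hasLimitColor_of_mem hw', hw⟩
        · exact absurd (h (a + 1) hξV) h'

end Generic

/-! ### The diagonalization -/

theorem exists_cylinder_subset {V : Set (ℕ → ℕ)} (hV : IsOpen V) {ξ₀ : ℕ → ℕ} (h : ξ₀ ∈ V) :
    ∃ s, ∀ ξ : ℕ → ℕ, (∀ x < s, ξ x = ξ₀ x) → ξ ∈ V := by
  obtain ⟨I, u, hu, hIu⟩ := isOpen_pi_iff.mp hV ξ₀ h
  refine ⟨I.sup id + 1, fun ξ hξ => hIu fun i hi => ?_⟩
  rw [hξ i (Nat.lt_succ_of_le (Finset.le_sup (f := id) hi))]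
  exact (hu i hi).2

theorem isOpen_cylinder (ξ₀ : ℕ → ℕ) (s : ℕ) : IsOpen {ξ : ℕ → ℕ | ∀ x < s, ξ x = ξ₀ x} := by
  have : {ξ : ℕ → ℕ | ∀ x < s, ξ x = ξ₀ x} = (Iio s).pi fun x => {ξ₀ x} := by
    ext ξ; simp [Set.mem_pi]
  rw [this]
  exact isOpen_set_pi (finite_Iio s) fun _ _ => isOpen_discrete _

/-- No continuous `D` and Turing functional `Ψ` reduce `SRT²₂` to `D²` with finitely many colors. -/
theorem not_continuously_reducible (D : (ℕ → ℕ) → ℕ → ℕ) (Ψ : OracleCode)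
    (hD : ContinuousOn D {c | IsStableColoring 2 c})
    (hst : ∀ c, IsStableColoring 2 c → ∃ k, IsStableColoring k (D c))
    (hΨ : ∀ c, IsStableColoring 2 c → ∀ L : Set ℕ, L.Infinite → IsLimitHomogeneous (D c) L →
      ∃ Y, Ψ.Computes (join c (charFun L)) Y ∧ (SRT2 2).IsSolution c Y) : False := by
  obtain ⟨V, n, k, G, hV, ⟨ξ₀, hξ₀⟩, hG, hVG⟩ := exists_open_dense_infinite_colors
    (d := fun ξ => D (bitColoring ξ))
    (hD.comp_continuous continuous_bitColoring isStableColoring_bitColoring)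
    (fun ξ => hst _ (isStableColoring_bitColoring ξ))
  obtain ⟨s, hs⟩ := exists_cylinder_subset hV hξ₀
  have hex : ∀ M, ∃ ξ ∈ G, ∀ x < s + M, ξ x = if x < s then ξ₀ x else 2 ^ M - 1 := fun M => by
    obtain ⟨ξ, h1, h2⟩ := hG.inter_open_nonempty _
      (isOpen_cylinder (fun x => if x < s then ξ₀ x else 2 ^ M - 1) (s + M)) ⟨_, fun _ _ => rfl⟩
    exact ⟨ξ, h2, h1⟩
  choose ξ hξG hξ using hex
  have hξV : ∀ M, ξ M ∈ V ∩ G := fun M =>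
    ⟨hs _ fun x hx => by rw [hξ M x (by omega), if_pos hx], hξG M⟩
  have hcol : ∀ M x, ∃ j : Fin k, HasLimitColor (D (bitColoring (ξ M))) x j := fun M x => by
    obtain ⟨j, hj, h⟩ := (hVG _ (hξV M)).1.2 x
    exact ⟨⟨j, hj⟩, h⟩
  choose p hp using hcol
  -- The common bound `k` makes `ℕ → Fin k` compact.
  obtain ⟨q, φ, hφ, hq⟩ := CompactSpace.tendsto_subseq p
  have hq' : ∀ x, ∀ᶠ i in atTop, p (φ i) x = q x := fun x => by
    have := tendsto_pi_nhds.mp hq x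
    rwa [nhds_discrete, tendsto_pure] at this
  set c := truncColoring ξ₀ s with hc
  have hcst : IsStableColoring 2 c := isStableColoring_truncColoring ξ₀ s
  obtain ⟨k', hk'⟩ := hst c hcst
  have hcol' : ∀ x, ∃ j : Fin k', HasLimitColor (D c) x j := fun x => by
    obtain ⟨j, hj, h⟩ := hk'.2 x
    exact ⟨⟨j, hj⟩, h⟩
  choose r hr using hcol'
  -- Pigeonhole on pairs of colors; the shift by `n` keeps `L` in the range where genericity
  -- applies.
  obtain ⟨⟨a, b⟩, hab⟩ := Finite.exists_infinite_fiber fun x => (r (n + x), q (n + x))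
  have hinj : Function.Injective fun x => n + x := add_right_injective n
  have hL₁ := (Set.infinite_coe_iff.mp hab).image hinj.injOn
  set L := (fun x => n + x) '' ((fun x => (r (n + x), q (n + x))) ⁻¹' {(a, b)}) with hL
  have hLn : ∀ x ∈ L, n ≤ x ∧ r x = a ∧ q x = b := by
    rintro _ ⟨x, hx, rfl⟩
    simpa using hx
  obtain ⟨Y, hY, H, hHY, hHinf, hHom⟩ := hΨ c hcst L hL₁
    ⟨a, fun x hx => (hLn x hx).2.1 ▸ hr x⟩
  obtain ⟨x, hx, hsx⟩ := hHinf.exists_gt s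
  obtain ⟨y, hy, hxy⟩ := hHinf.exists_gt x
  have hc0 : c (Nat.pair x y) = 0 := eq_limitColor_of_homogeneous hHinf hHom hx hy hxy hx
    (hasLimitColor_truncColoring_of_le ξ₀ hsx.le)
  have hone : ∀ w ∈ H, 1 ∈ Ψ.eval (join c (charFun L)) w := fun w hw => by
    rw [hY w, Part.mem_some_iff]
    rcases hHY w with h | h
    exacts [h.2.symm, absurd hw h.1]
  -- Below `i` only elements of `L` are allowed, which forces convergence to `L`; from `i` on every
  -- point of color `b` is admitted, to make the set infinite.
  set L' : ℕ → Set ℕ := fun i => {w | p (φ i) w = b ∧ (w ∈ L ∨ i ≤ w)} with hL'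
  have hcT : Tendsto (fun i => bitColoring (ξ (φ i))) atTop (𝓝 c) :=
    (tendsto_bitColoring_truncColoring hξ).comp hφ.tendsto_atTop
  have hLT : Tendsto (fun i => charFun (L' i)) atTop (𝓝 (charFun L)) := by
    refine tendsto_pi_nhds.mpr fun w => tendsto_nhds_of_eventually_eq ?_
    filter_upwards [hq' w, eventually_gt_atTop w] with i h1 h2
    have : w ∈ L' i ↔ w ∈ L := by
      simp only [hL', mem_ofPred_eq, h1, h2.not_ge, or_false]
      exact ⟨fun h => h.2, fun h => ⟨(hLn w h).2.2, h⟩⟩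
    by_cases hw : w ∈ L <;> simp [charFun, this, hw]
  have hJ : Tendsto (fun i => join (bitColoring (ξ (φ i))) (charFun (L' i))) atTop
      (𝓝 (join c (charFun L))) :=
    (continuous_join.tendsto (c, charFun L)).comp (hcT.prodMk_nhds hLT)
  have hc0' : ∀ᶠ i in atTop, bitColoring (ξ (φ i)) (Nat.pair x y) = 0 := by
    have := tendsto_pi_nhds.mp hcT (Nat.pair x y)
    rwa [nhds_discrete, tendsto_pure, hc0] at this
  obtain ⟨w, hw⟩ := hL₁.nonempty
  obtain ⟨i, hi0, hix, hiy, hiw⟩ := (hc0'.and ((hJ.eventually (Ψ.eventually_mem_eval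
    (hone x hx))).and ((hJ.eventually (Ψ.eventually_mem_eval (hone y hy))).and (hq' w)))).exists
  have hinf : (L' i).Infinite := by
    -- Color `b` occurs at `w ≥ n`, hence infinitely often by genericity.
    have h1 := (hVG _ (hξV (φ i))).2 w (hLn w hw).1 _ (hp (φ i) w)
    refine (h1.sdiff (finite_Iio i)).mono fun v hv => ⟨?_, Or.inr (not_lt.mp hv.2)⟩
    rw [← (hLn w hw).2.2, ← hiw]
    exact Fin.ext ((hp (φ i) v).unique hv.1)
  obtain ⟨Y', hY', H', hHY', hHinf', hHom'⟩ := hΨ _ (isStableColoring_bitColoring (ξ (φ i))) _ hinf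
    ⟨b, fun v hv => hv.1 ▸ hp (φ i) v⟩
  have hmem : ∀ v, 1 ∈ Ψ.eval (join (bitColoring (ξ (φ i))) (charFun (L' i))) v → v ∈ H' :=
    fun v hv => by
      rw [hY' v, Part.mem_some_iff] at hv
      rcases hHY' v with h | h
      · exact h.1
      · omega
  have := eq_limitColor_of_homogeneous hHinf' hHom' (hmem x hix) (hmem y hiy) hxy (hmem x hix)
    (hasLimitColor_bitColoring _ x)
  omega

/-- The map `e` locates the coloring inside the code of an instance, so all three variants are
treated at once. -/
theorem not_uniformlyReducible_of_limitHomogeneous (P : Principle) (e : ℕ → ℕ)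
    (hinst : ∀ X, P.IsInstance X → ∃ k, IsStableColoring k fun n => X (e n))
    (hsol : ∀ X, P.IsInstance X → ∀ L : Set ℕ, L.Infinite →
      IsLimitHomogeneous (fun n => X (e n)) L → P.IsSolution X (charFun L)) :
    ¬ UniformlyReducible (SRT2 2) P := by
  rintro ⟨Φ, Ψ, h⟩
  choose! D hΦ hP hΨ using h
  refine not_continuously_reducible (fun c n => D c (e n)) Ψ ?_ (fun c hc => hinst _ (hP c hc))
    fun c hc L hL hhom => hΨ c hc _ (hsol _ (hP c hc) L hL hhom)
  have h1 : ContinuousOn D {c | IsStableColoring 2 c} := OracleCode.continuousOn_of_computes hΦ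
  exact (by fun_prop : Continuous fun (X : ℕ → ℕ) n => X (e n)).comp_continuousOn h1

end RamseyReductions

theorem mainTheorem8 :
    ¬ RamseyReductions.UniformlyReducible (RamseyReductions.SRT2 2) RamseyReductions.D2Fin ∧
    ¬ RamseyReductions.UniformlyReducible (RamseyReductions.SRT2 2)
        RamseyReductions.D2FinUnknown ∧
    ¬ RamseyReductions.UniformlyReducible (RamseyReductions.SRT2 2) (RamseyReductions.D2 2) := by
  open RamseyReductions in
  refine ⟨?_, ?_, ?_⟩
  · exact not_uniformlyReducible_of_limitHomogeneous _ (fun n => n + 1) (fun X hX => ⟨X 0, hX⟩)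
      fun X _ L hL h => ⟨L, isCharFun_charFun L, hL, h⟩
  · exact not_uniformlyReducible_of_limitHomogeneous _ id (fun X hX => hX)
      fun X _ L hL h => ⟨L, isCharFun_charFun L, hL, h⟩
  · exact not_uniformlyReducible_of_limitHomogeneous _ id (fun X hX => ⟨2, hX⟩)
      fun X _ L hL h => ⟨L, isCharFun_charFun L, hL, h⟩
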